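/- Let $n\ge 0$ and $k\ge 1$ be integers and let $S\subseteq\binom{[n]}{k}$ be a non-empty family of $k$-element subsets of $[n]=\{1,\dots,n\}$. For a family $T$ of sets let $\Delta(T)=\{A\setminus\{a\} : A\in T,\ a\in A\}$ be its lower shadow, and put $\Delta^0(S)=S$, $\Delta^i(S)=\Delta(\Delta^{i-1}(S))$. For $m,j\in\mathbb Z$ let $\binom{m}{j}=\frac{m(m-1)\cdots(m-j+1)}{j!}$ if $j\ge 1$, $\binom{m}{0}=1$, and $\binom{m}{j}=0$ if $j<0$. The shadow $k$-binomial decomposition of $S$ is the unique sequence $(\beta_0,\dots,\beta_{k-1})$ of (not necessarily positive) integers such that, for every $0\le i\le k-1$, $$|\Delta^i(S)|=\binom{\beta_0}{k-i}+\binom{\beta_1}{k-i-1}+\cdots+\binom{\beta_{k-1}}{1-i}.$$ **Theorem (Monotonicity of the shadow $k$-binomial decomposition).** The shadow $k$-binomial decomposition $(\beta_0,\dots,\beta_{k-1})$ of $S$ satisfies $\beta_0>\beta_1>\cdots>\beta_{k-2}\ge\beta_{k-1}$, that is, $\beta_i>\beta_{i+1}$ for $0\le i\le k-3$ and, if $k\ge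 2$, $\beta_{k-2}\ge\beta_{k-1}$. -/

import Mathlib

/-- The binomial coefficient `n (n - 1) ⋯ (n - k + 1) / k!` for an arbitrary integer `n`, which is
`1` for `k = 0` and is set to `0` for negative `k`. -/
noncomputable def intBinom (n k : ℤ) : ℤ :=
  if k < 0 then 0 else Ring.choose n k.toNat

/-- `β = (β 0, …, β (k - 1))` is the shadow `k`-binomial decomposition of the family `S` of
`k`-subsets: for each `0 ≤ i ≤ k - 1`, the `i`-th iterated lower shadow of `S` has
`∑ j, binom (β j) (k - i - j)` elements. By `existsUnique_isShadowBinomialDecomposition` below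
there is exactly one such sequence. -/
def IsShadowBinomialDecomposition {α : Type*} [DecidableEq α] (k : ℕ) (S : Finset (Finset α))
    (β : Fin k → ℤ) : Prop :=
  ∀ i : ℕ, i < k →
    ((Finset.shadow^[i] S).card : ℤ) = ∑ j : Fin k, intBinom (β j) ((k : ℤ) - (i : ℤ) - (j : ℤ))

/-- The recursive description of the shadow `k`-binomial decomposition: `β t` is
`|Δ^(k - 1 - t) S| - ∑ j < t, binom (β j) (t + 1 - j) - 1` for `t < k - 1`, and the same expression
without the final `- 1` for `t = k - 1`. -/
noncomputable def shadowBinomialCoeff {α : Type*} [DecidableEq α] (k : ℕ) (S : Finset (Finset α))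
    (t : ℕ) : ℤ :=
  ((Finset.shadow^[k - 1 - t] S).card : ℤ)
    - ∑ j : Fin t, intBinom (shadowBinomialCoeff k S j) ((t : ℤ) + 1 - (j : ℤ))
    - if t + 1 < k then 1 else 0
termination_by t
decreasing_by exact j.2

theorem sum_intBinom_eq {k : ℕ} (β : Fin k → ℤ) (t : ℕ) (ht : t < k) :
    ∑ j : Fin k, intBinom (β j) ((t : ℤ) + 1 - (j : ℤ)) =
      ∑ j : Fin t, intBinom (β ⟨j, j.2.trans ht⟩) ((t : ℤ) + 1 - (j : ℤ)) + β ⟨t, ht⟩ +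
        if t + 1 < k then 1 else 0 := by
  obtain ⟨m, rfl⟩ : ∃ m, k = t + 1 + m := ⟨k - (t + 1), by omega⟩
  rw [Fin.sum_univ_add, Fin.sum_univ_castSucc]
  congr 1
  · congr 1
    simp [intBinom, Fin.castAdd, Fin.castLE]
  · cases m with
    | zero => simp
    | succ m =>
      rw [Fin.sum_univ_succ, Finset.sum_eq_zero]
      · simp [intBinom]
      · intro x _
        apply if_pos
        simp only [Fin.val_natAdd, Fin.val_succ]
        push_cast
        omega

/-- The description by the cardinalities of the iterated shadows and the recursive one agree. -/
theorem isShadowBinomialDecomposition_iff {α : Type*} [DecidableEq α] (k : ℕ)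
    (S : Finset (Finset α)) (β : Fin k → ℤ) :
    IsShadowBinomialDecomposition k S β ↔ β = fun t : Fin k => shadowBinomialCoeff k S t := by
  have key : IsShadowBinomialDecomposition k S β ↔ ∀ t (ht : t < k),
      ((Finset.shadow^[k - 1 - t] S).card : ℤ) =
        ∑ j : Fin t, intBinom (β ⟨j, j.2.trans ht⟩) ((t : ℤ) + 1 - (j : ℤ)) + β ⟨t, ht⟩ +
          if t + 1 < k then 1 else 0 := by
    constructor
    · intro h t ht
      rw [h (k - 1 - t) (by omega), ← sum_intBinom_eq β t ht]
      refine Finset.sum_congr rfl fun j _ => ?_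
      congr 1
      omega
    · intro h i hi
      have h1 := h (k - 1 - i) (by omega)
      rw [← sum_intBinom_eq β _ (by omega), show k - 1 - (k - 1 - i) = i by omega] at h1
      rw [h1]
      refine Finset.sum_congr rfl fun j _ => ?_
      congr 1
      omega
  rw [key]
  constructor
  · intro h
    have : ∀ t (ht : t < k), β ⟨t, ht⟩ = shadowBinomialCoeff k S t := by
      intro t
      induction t using Nat.strong_induction_on with
      | _ t ih =>
        intro ht
        rw [shadowBinomialCoeff, h t ht,
          Finset.sum_congr rfl fun (j : Fin t) _ => by rw [ih j j.2 (j.2.trans ht)]]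
        ring
    funext t
    exact this t t.2
  · rintro rfl t ht
    dsimp only
    have h := shadowBinomialCoeff.eq_def k S t
    linarith

/-- The shadow `k`-binomial decomposition exists and is unique. -/
theorem existsUnique_isShadowBinomialDecomposition {α : Type*} [DecidableEq α] (k : ℕ)
    (S : Finset (Finset α)) : ∃! β : Fin k → ℤ, IsShadowBinomialDecomposition k S β := by
  simp only [isShadowBinomialDecomposition_iff, existsUnique_eq]

/-! Lowering only the last entry of `β` by 1 gives `γ` with g(r) = ∑_{j<r} C(γ_j, r-j) + 1, where
g(r) is the number of r-sets in the iterated shadow, 1 ≤ r ≤ k. The claim becomes strict decrease of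
`γ`.

Kruskal–Katona, in cascade form, turns a bound on g(r) into one on g(r+1) by raising all lower
indices (`card_le_of_card_shadow_le_cascade`). While γ_t ≥ -1, the cascade γ_0, …, γ_{t-1}, γ_t + 1
gives exactly g(t+1), and the resulting bound on g(t+2) says γ_{t+1} < γ_t.

If γ_l is the first negative entry, the cascade cut off before l bounds every later g(r). With δ_i =
-γ_{l+i}, the series ∑ x^i (1+x)^{-δ_i} then has no positive coefficient in degrees 1, …, k-l, which
algebraically forces δ to increase (`strictMono_of_sum_choose_neg_nonpos`). -/

/-! ### Colex initial segments and Kruskal–Katona for cascades -/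

open Finset in
theorem card_initSeg_insert {n : ℕ} {m : Fin n} {t : Finset (Fin n)} (ht : ∀ x ∈ t, x < m) :
    #(Colex.initSeg (insert m t)) = (m : ℕ).choose (#t + 1) + #(Colex.initSeg t) := by
  have hmt : m ∉ t := fun h => lt_irrefl _ (ht m h)
  have hle : ∀ u : Finset (Fin n), m ∉ u →
      (toColex (insert m u) ≤ toColex (insert m t) ↔ toColex u ≤ toColex t) := by
    intro u hu
    rw [← Colex.toColex_sdiff_le_toColex_sdiff (u := {m}) (by simp) (by simp),
      sdiff_singleton_eq_erase, sdiff_singleton_eq_erase, erase_insert hu, erase_insert hmt]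
  have hlt : ∀ u, toColex u ≤ toColex t → m ∉ u := fun u hu hm =>
    lt_irrefl _ (Colex.forall_lt_mono hu ht m hm)
  -- Colex compares largest elements first: sets avoiding `m` are unconstrained below `m`, sets
  -- containing it are compared after erasing it.
  have key : Colex.initSeg (insert m t) =
      powersetCard (#t + 1) (Iio m) ∪ (Colex.initSeg t).image (insert m) := by
    ext s
    rw [mem_union, mem_powersetCard, mem_image, Colex.mem_initSeg, card_insert_of_notMem hmt]
    constructor
    · rintro ⟨hc, hs⟩
      by_cases hm : m ∈ s
      · right
        refine ⟨s.erase m, ?_, insert_erase hm⟩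
        rw [Colex.mem_initSeg, card_erase_of_mem hm, ← hle _ (notMem_erase m s), insert_erase hm]
        exact ⟨by omega, hs⟩
      · left
        refine ⟨fun x hx => ?_, hc.symm⟩
        have h1 : x ≤ m := Colex.forall_le_mono hs (a := m) (by
          intro b hb
          rcases mem_insert.1 hb with rfl | hb
          · exact le_rfl
          · exact (ht b hb).le) x hx
        rw [mem_Iio]
        exact lt_of_le_of_ne h1 fun h => hm (h ▸ hx)
    · rintro (⟨hs, hc⟩ | ⟨u, hu, rfl⟩)
      · refine ⟨hc.symm, ?_⟩
        rw [Colex.toColex_le_toColex]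
        intro a ha _
        exact ⟨m, mem_insert_self _ _, fun h => lt_irrefl _ (mem_Iio.1 (hs h)),
          (mem_Iio.1 (hs ha)).le⟩
      · rw [Colex.mem_initSeg] at hu
        have hmu := hlt u hu.2
        exact ⟨by rw [card_insert_of_notMem hmu, hu.1], (hle u hmu).2 hu.2⟩
  rw [key, card_union_of_disjoint, card_powersetCard, Fin.card_Iio, card_image_of_injOn]
  · intro u hu v hv huv
    have hu := hlt u (Colex.mem_initSeg.1 hu).2
    have hv := hlt v (Colex.mem_initSeg.1 hv).2
    rw [← erase_insert hu, ← erase_insert hv, huv]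
  · rw [disjoint_left]
    intro s hs hs'
    obtain ⟨u, -, rfl⟩ := mem_image.1 hs'
    exact lt_irrefl _ (mem_Iio.1 ((mem_powersetCard.1 hs).1 (mem_insert_self m u)))

open Finset in
/-- The position in the colex order of a set with elements `a 0 > a 1 > ⋯ > a (L - 1)`. -/
theorem card_initSeg_image {n : ℕ} (L : ℕ) (a : ℕ → Fin n) (ha : ∀ i j, i < j → j < L → a j < a i) :
    #((range L).image a) = L ∧
      #(Colex.initSeg ((range L).image a)) = ∑ j ∈ range L, (a j : ℕ).choose (L - j) + 1 := by
  induction L generalizing a with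
  | zero =>
    refine ⟨rfl, ?_⟩
    have : Colex.initSeg (∅ : Finset (Fin n)) = {∅} := by
      ext s
      rw [Colex.mem_initSeg, mem_singleton, card_empty, eq_comm, card_eq_zero]
      exact ⟨fun h => h.1, fun h => ⟨h, by rw [h]⟩⟩
    simp [this]
  | succ L ih =>
    obtain ⟨h1, h2⟩ := ih (fun j => a (j + 1)) fun i j hij hj => ha _ _ (by omega) (by omega)
    have hins : (range (L + 1)).image a = insert (a 0) ((range L).image fun j => a (j + 1)) := by
      ext x
      simp only [mem_image, mem_range, mem_insert]
      constructor
      · rintro ⟨_ | j, hj, rfl⟩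
        · exact Or.inl rfl
        · exact Or.inr ⟨j, by omega, rfl⟩
      · rintro (rfl | ⟨j, hj, rfl⟩)
        · exact ⟨0, by omega, rfl⟩
        · exact ⟨j + 1, by omega, rfl⟩
    have hlt : ∀ x ∈ (range L).image (fun j => a (j + 1)), x < a 0 := by
      intro x hx
      obtain ⟨j, hj, rfl⟩ := mem_image.1 hx
      exact ha _ _ (by omega) (by have := mem_range.1 hj; omega)
    rw [hins]
    refine ⟨?_, ?_⟩
    · rw [card_insert_of_notMem fun h => lt_irrefl _ (hlt _ h), h1]
    · rw [card_initSeg_insert hlt, h1, h2, sum_range_succ']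
      simp only [Nat.add_sub_add_right, Nat.sub_zero]
      ring

-- If `F` were larger, it would be at least as large as the initial segment ending at {a_0, …, a_r}.
-- Since a_r = 0 is the minimum, the shadow of that segment ends at {a_0, …, a_{r-1}}, and its size
-- exceeds the assumed bound by one.
open Finset FinsetFamily in
theorem card_le_of_card_shadow_le_full {n r : ℕ} {F : Finset (Finset (Fin n))}
    (hF : (F : Set (Finset (Fin n))).Sized (r + 1)) (a : ℕ → Fin n)
    (ha : ∀ i j, i < j → j < r + 1 → a j < a i) (h0 : (a r : ℕ) = 0)
    (h : #(∂ F) ≤ ∑ j ∈ range r, (a j : ℕ).choose (r - j)) :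
    #F ≤ ∑ j ∈ range r, (a j : ℕ).choose (r + 1 - j) := by
  by_contra! hlt
  obtain ⟨hc, hs⟩ := card_initSeg_image (r + 1) a ha
  obtain ⟨-, hs'⟩ := card_initSeg_image r a fun i j hij hj => ha i j hij (by omega)
  have hne : ((range (r + 1)).image a).Nonempty := ⟨a r, mem_image_of_mem _ (by simp)⟩
  have hseg : Colex.IsInitSeg (Colex.initSeg ((range (r + 1)).image a)) (r + 1) := by
    have := Colex.isInitSeg_initSeg (s := (range (r + 1)).image a)
    rwa [hc] at this
  have hmin : ((range (r + 1)).image a).min' hne = a r := by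
    apply le_antisymm
    · exact min'_le _ _ (mem_image_of_mem _ (by simp))
    · rw [Fin.le_def, h0]
      exact Nat.zero_le _
  have herase : ((range (r + 1)).image a).erase (a r) = (range r).image a := by
    rw [range_add_one, image_insert, erase_insert]
    intro hm
    obtain ⟨j, hj, hja⟩ := mem_image.1 hm
    exact (ha j r (mem_range.1 hj) (by omega)).ne hja.symm
  have hkk := kruskal_katona hF (by
    rw [hs, sum_range_succ, h0]
    simpa using hlt) hseg
  rw [Colex.shadow_initSeg hne, hmin, herase, hs'] at hkk
  omega

open Finset FinsetFamily in
theorem card_le_of_card_shadow_le_strict {n r : ℕ} {F : Finset (Finset (Fin n))}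
    (hF : (F : Set (Finset (Fin n))).Sized (r + 1)) (l : ℕ) (a : ℕ → ℕ) (hl : l ≤ r)
    (ha : ∀ i j, i < j → j < l → a j < a i)
    (h : #(∂ F) ≤ ∑ j ∈ range l, (a j).choose (r - j)) :
    #F ≤ ∑ j ∈ range l, (a j).choose (r + 1 - j) := by
  induction l with
  | zero =>
    simp only [range_zero, sum_empty, nonpos_iff_eq_zero, card_eq_zero] at h ⊢
    by_contra hne
    obtain ⟨A, hA⟩ := nonempty_iff_ne_empty.2 hne
    obtain ⟨x, hx⟩ := card_pos.1 (show 0 < #A by rw [hF hA]; omega)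
    have := erase_mem_shadow hA hx
    rw [h] at this
    exact notMem_empty _ this
  | succ l ih =>
    by_cases hn : n ≤ a 0
    · have h1 : #F ≤ n.choose (r + 1) := by simpa using hF.card_le
      refine h1.trans ((Nat.choose_le_choose _ hn).trans ?_)
      exact single_le_sum (f := fun j => (a j).choose (r + 1 - j)) (fun _ _ => Nat.zero_le _)
        (mem_range.2 (Nat.succ_pos l))
    push Not at hn
    -- Here the last term vanishes in both sums and can be dropped.
    by_cases hal : a l < r - l
    · rw [sum_range_succ, Nat.choose_eq_zero_of_lt (by omega)] at h ⊢
      exact ih (by omega) (fun i j hij hj => ha i j hij (by omega)) h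
    push Not at hal
    have hbig : ∀ j, j ≤ l → r - l ≤ a j ∧ a j ≤ a 0 := by
      intro j hj
      constructor
      · rcases hj.eq_or_lt with rfl | hj
        · exact hal
        · exact hal.trans (ha j l hj (by omega)).le
      · rcases Nat.eq_zero_or_pos j with rfl | h0
        · exact le_rfl
        · exact (ha 0 j h0 (by omega)).le
    have hbl := hbig l le_rfl
    -- Padding by r - j keeps the sequence strictly decreasing down to 0. The new terms C(r-j,
    -- r+1-j) vanish in the conclusion and only enlarge the bound on the shadow.
    let b : ℕ → ℕ := fun j => if j < l + 1 then a j else r - j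
    have hb : ∀ j, b j < n := by
      intro j
      by_cases hj : j < l + 1
      · have := hbig j (by omega)
        simp only [b, hj, if_true]; omega
      · simp only [b, hj, if_false]; omega
    have hsub : range (l + 1) ⊆ range r := range_subset_range.2 hl
    have hsum : ∀ s, ∑ j ∈ range (l + 1), (b j).choose (s - j) =
        ∑ j ∈ range (l + 1), (a j).choose (s - j) := fun s =>
      sum_congr rfl fun j hj => by simp only [b, if_pos (mem_range.1 hj)]
    have h2 := card_le_of_card_shadow_le_full hF (fun j => ⟨b j, hb j⟩) ?_ ?_ ?_
    · refine h2.trans (le_of_eq ?_)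
      rw [← hsum]
      refine (sum_subset hsub fun j hj hj' => ?_).symm
      have h3 : ¬ j < l + 1 := fun h => hj' (mem_range.2 h)
      have h4 := mem_range.1 hj
      simp only [b, if_neg h3]
      exact Nat.choose_eq_zero_of_lt (by omega)
    · intro i j hij hj
      simp only [Fin.mk_lt_mk, b]
      split_ifs with h3 h4 h4
      · exact ha i j hij h3
      · omega
      · have := (hbig i (by omega)).1
        omega
      · omega
    · simp only [b]
      rw [if_neg (by omega), Nat.sub_self]
    · refine h.trans ?_
      rw [← hsum]
      exact sum_le_sum_of_subset hsub

open Finset FinsetFamily in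
/-- The **Kruskal–Katona theorem** in cascade form, where the last two terms of the cascade may
agree. -/
theorem card_le_of_card_shadow_le_cascade {n r : ℕ} {F : Finset (Finset (Fin n))}
    (hF : (F : Set (Finset (Fin n))).Sized (r + 1)) (l : ℕ) (a : ℕ → ℕ) (c : ℕ) (hl : l + 1 ≤ r)
    (ha : ∀ i j, i < j → j < l → a j < a i) (hc : ∀ j, j + 1 = l → c ≤ a j)
    (h : #(∂ F) ≤ ∑ j ∈ range l, (a j).choose (r - j) + c.choose (r - l)) :
    #F ≤ ∑ j ∈ range l, (a j).choose (r + 1 - j) + c.choose (r + 1 - l) := by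
  -- Two equal last entries merge by Pascal's rule into one entry larger by 1, which may again equal
  -- its predecessor; hence the recursion on `l`.
  by_cases hcl : ∃ j, j + 1 = l ∧ c = a j
  · obtain ⟨l, rfl, rfl⟩ := hcl
    have hp : ∀ s, l + 1 ≤ s → ∑ j ∈ range (l + 1), (a j).choose (s - j) +
        (a l).choose (s - (l + 1)) = ∑ j ∈ range l, (a j).choose (s - j) +
          (a l + 1).choose (s - l) := by
      intro s hs
      obtain ⟨m, rfl⟩ := Nat.exists_eq_add_of_le hs
      rw [sum_range_succ, show l + 1 + m - l = m + 1 by omega,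
        show l + 1 + m - (l + 1) = m by omega, Nat.choose_succ_succ]
      ring
    rw [hp _ (by omega)] at h ⊢
    refine card_le_of_card_shadow_le_cascade hF l a (a l + 1) (by omega)
      (fun i j hij hj => ha i j hij (by omega)) (fun j hj => ?_) h
    exact ha j l (by omega) (by omega)
  · push Not at hcl
    have hp : ∀ s, ∑ j ∈ range (l + 1), (if j < l then a j else c).choose (s - j) =
        ∑ j ∈ range l, (a j).choose (s - j) + c.choose (s - l) := by
      intro s
      rw [sum_range_succ, if_neg (lt_irrefl l)]
      congr 1
      exact sum_congr rfl fun j hj => by rw [if_pos (mem_range.1 hj)]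
    rw [← hp] at h ⊢
    refine card_le_of_card_shadow_le_strict hF (l + 1) _ hl ?_ h
    intro i j hij hj
    rw [if_pos (show i < l by omega)]
    split_ifs with h1
    · exact ha i j hij h1
    · have hjl : l - 1 + 1 = l := by omega
      have h2 := (hc _ hjl).lt_of_ne (hcl _ hjl)
      rcases (show i ≤ l - 1 by omega).eq_or_lt with rfl | h3
      · exact h2
      · exact h2.trans (ha i _ h3 (by omega))
termination_by l

/-! ### Power series with negative exponents -/

theorem sum_Ioc_choose_neg {v b : ℤ} (h : v ≤ b) (q : ℕ) :
    ∑ w ∈ Finset.Ioc v b, Ring.choose (-w) q =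
      Ring.choose (-v) (q + 1) - Ring.choose (-b) (q + 1) := by
  induction b, h using Int.leInduction with
  | base => simp
  | succ b hb ih =>
    have h1 : Finset.Ioc v (b + 1) = insert (b + 1) (Finset.Ioc v b) := by
      ext x
      simp only [Finset.mem_insert, Finset.mem_Ioc]
      omega
    have h2 := Ring.choose_succ_succ (-(b + 1)) q
    rw [show -(b + 1) + 1 = -b by ring] at h2
    rw [h1, Finset.sum_insert (by simp), ih, h2]
    ring

/-- The difference of the two binomials is minus the sum of C(-b, q+1) over d < b ≤ d+s. Each such b
is paired with a distinct v in `M`, and C(-v, q+1) - C(-b, q+1) telescopes into the sum of C(-w, q)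
over v < w ≤ b. -/
theorem exists_multiset_sum_choose_neg (s : ℕ) {d : ℤ} (hd : 0 ≤ d) (M : Multiset ℤ)
    (hM : ∀ v ∈ M, v ≤ d) (hs : M.card ≤ s) :
    ∃ N : Multiset ℤ, (∀ w ∈ N, w ≤ d + s) ∧ ∀ q : ℕ,
      (M.map fun v => Ring.choose (-v) (q + 1)).sum + Ring.choose (-(d + s)) (q + 2) -
        Ring.choose (-d) (q + 2) = (N.map fun w => Ring.choose (-w) q).sum := by
  induction s generalizing M with
  | zero =>
    obtain rfl : M = 0 := by simpa using hs
    exact ⟨0, by simp, by simp⟩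
  | succ s ih =>
    obtain ⟨v, hv, M₀, hM₀, hc, hsum⟩ : ∃ v, v ≤ d ∧ ∃ M₀ : Multiset ℤ, (∀ v ∈ M₀, v ≤ d) ∧
        M₀.card ≤ s ∧ ∀ q : ℕ, (M.map fun v => Ring.choose (-v) (q + 1)).sum =
          Ring.choose (-v) (q + 1) + (M₀.map fun v => Ring.choose (-v) (q + 1)).sum := by
      rcases Multiset.empty_or_exists_mem M with rfl | ⟨v, hv⟩
      -- When `M` runs out, v = 0 serves as partner, since C(0, q+1) = 0.
      · exact ⟨0, hd, 0, by simp, by simp, by simp⟩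
      · obtain ⟨M₀, rfl⟩ := Multiset.exists_cons_of_mem hv
        refine ⟨v, hM v hv, M₀, fun w hw => hM w (Multiset.mem_cons_of_mem hw), ?_, by simp⟩
        simpa using hs
    obtain ⟨N, hN, hNsum⟩ := ih M₀ hM₀ hc
    refine ⟨(Finset.Ioc v (d + (s + 1))).val + N, ?_, fun q => ?_⟩
    · intro w hw
      rcases Multiset.mem_add.1 hw with hw | hw
      · have := (Finset.mem_Ioc.1 (show w ∈ Finset.Ioc v (d + (s + 1)) from hw)).2
        push_cast
        exact this
      · have := hN w hw
        push_cast
        omega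
    · have h1 := sum_Ioc_choose_neg (show v ≤ d + (s + 1) by omega) q
      have h2 := Ring.choose_succ_succ (-(d + (s + 1))) (q + 1)
      rw [show -(d + ((s : ℤ) + 1)) + 1 = -(d + s) by ring] at h2
      have h3 := hNsum q
      rw [Multiset.map_add, Multiset.sum_add, hsum, ← h3]
      rw [Finset.sum] at h1
      rw [h1]
      push_cast
      linarith

/-- If `∑ i, x ^ i * (1 + x) ^ (- δ i)` has no positive coefficient in the degrees `1, …, K`, then
`δ` is increasing. -/
theorem strictMono_of_sum_choose_neg_nonpos {K : ℕ} {δ : ℕ → ℤ}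
    (h : ∀ m, 1 ≤ m → m ≤ K → ∑ i ∈ Finset.range (m + 1), Ring.choose (-δ i) (m - i) ≤ 0)
    (m : ℕ) (hm : m + 2 ≤ K) : δ m < δ (m + 1) := by
  -- At q = 0 the right side counts `M`; Pascal's rule for C(1-δ_m, 2) and the hypothesis in degree
  -- m+2 give the gap.
  have step : ∀ (m : ℕ) (M : Multiset ℤ), m + 2 ≤ K →
      (∀ q : ℕ, ∑ i ∈ Finset.range m, Ring.choose (-δ i) (m + 2 + q - i) +
        Ring.choose (1 - δ m) (q + 2) = (M.map fun v => Ring.choose (-v) q).sum) →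
      δ m + M.card < δ (m + 1) := by
    intro m M hm hM
    have h1 := h (m + 2) (by omega) hm
    have h2 := hM 0
    have h3 := Ring.choose_succ_succ (-δ m) 1
    rw [show -δ m + 1 = 1 - δ m by ring] at h3
    rw [Finset.sum_range_succ, Finset.sum_range_succ, Finset.sum_range_succ,
      show m + 2 - (m + 2) = 0 by omega, show m + 2 - (m + 1) = 1 by omega,
      show m + 2 - m = 2 by omega] at h1
    simp only [Ring.choose_zero_right, Ring.choose_one_right, add_zero, Multiset.map_const',
      Multiset.sum_replicate, zero_add, mul_one, nsmul_eq_mul, one_add_one_eq_two] at *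
    omega
  -- From degree m+2 on, ∑_{i<m} x^i (1+x)^{-δ_i} + x^m (1+x)^{1-δ_m} agrees with x^{m+2} ∑_{v∈M}
  -- (1+x)^{-v}. The gap from `step` leaves enough terms to pair off all of `M`, which carries this
  -- to m+1.
  have inv : ∀ m, m + 2 ≤ K → 1 ≤ δ m ∧ ∃ M : Multiset ℤ, (∀ v ∈ M, v ≤ δ m - 1) ∧
      ∀ q : ℕ, ∑ i ∈ Finset.range m, Ring.choose (-δ i) (m + 2 + q - i) +
        Ring.choose (1 - δ m) (q + 2) = (M.map fun v => Ring.choose (-v) q).sum := by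
    intro m
    induction m with
    | zero =>
      intro hK
      have h1 := h 1 le_rfl (by omega)
      rw [Finset.sum_range_succ, Finset.sum_range_one] at h1
      simp only [Nat.sub_zero, Nat.sub_self, Ring.choose_zero_right, Ring.choose_one_right] at h1
      obtain ⟨s, hs⟩ := Int.eq_ofNat_of_zero_le (show 0 ≤ δ 0 - 1 by omega)
      obtain ⟨N, hN, hsum⟩ := exists_multiset_sum_choose_neg s le_rfl 0 (by simp) (by simp)
      refine ⟨by omega, N, fun w hw => ?_, fun q => ?_⟩
      · have := hN w hw
        omega
      · rw [← hsum q, show 1 - δ 0 = -(0 + (s : ℤ)) by omega]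
        simp
    | succ m ih =>
      intro hK
      obtain ⟨hδ, M, hM, hsum⟩ := ih (by omega)
      have hlt := step m M (by omega) hsum
      obtain ⟨s, hs⟩ := Int.eq_ofNat_of_zero_le (show 0 ≤ δ (m + 1) - 1 - δ m by omega)
      obtain ⟨N, hN, hNsum⟩ := exists_multiset_sum_choose_neg s (d := δ m) (by omega) M
        (fun v hv => by have := hM v hv; omega) (by omega)
      refine ⟨by omega, N, fun w hw => ?_, fun q => ?_⟩
      · have := hN w hw
        omega
      · have h1 := hsum (q + 1)
        have h2 := Ring.choose_succ_succ (-δ m) (q + 2)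
        rw [show -δ m + 1 = 1 - δ m by ring] at h2
        rw [← hNsum q, Finset.sum_range_succ, show 1 - δ (m + 1) = -(δ m + s) by omega,
          show m + 1 + 2 + q - m = q + 3 by omega]
        rw [show m + 2 + (q + 1) = m + 1 + 2 + q by omega] at h1
        rw [← h1, show q + 1 + 2 = q + 2 + 1 by omega, h2]
        ring
  obtain ⟨-, M, -, hM⟩ := inv m hm
  have := step m M hm hM
  omega

/-! ### From Kruskal–Katona to decreasing coefficients -/

theorem sum_choose_toNat {l r : ℕ} {γ : ℕ → ℤ} (hγ : ∀ j < l, 0 ≤ γ j) :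
    ((∑ j ∈ Finset.range l, (γ j).toNat.choose (r - j) : ℕ) : ℤ) =
      ∑ j ∈ Finset.range l, Ring.choose (γ j) (r - j) := by
  push_cast
  refine Finset.sum_congr rfl fun j hj => ?_
  rw [← Ring.choose_natCast, Int.natCast_toNat_eq_self.2 (hγ j (Finset.mem_range.1 hj))]

/-- Numbers subject to the Kruskal–Katona inequalities have decreasing coefficients. -/
theorem coeff_lt_of_kruskal_katona {K : ℕ} {g : ℕ → ℕ} {γ : ℕ → ℤ}
    (hg : ∀ r, 1 ≤ r → r ≤ K →
      (g r : ℤ) = ∑ j ∈ Finset.range r, Ring.choose (γ j) (r - j) + 1)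
    (hKK : ∀ (r l : ℕ) (a : ℕ → ℕ) (c : ℕ), r + 1 ≤ K → l + 1 ≤ r →
      (∀ i j, i < j → j < l → a j < a i) → (∀ j, j + 1 = l → c ≤ a j) →
      g r ≤ ∑ j ∈ Finset.range l, (a j).choose (r - j) + c.choose (r - l) →
      g (r + 1) ≤ ∑ j ∈ Finset.range l, (a j).choose (r + 1 - j) + c.choose (r + 1 - l))
    (t : ℕ) (ht : t + 2 ≤ K) : γ (t + 1) < γ t := by
  induction t using Nat.strong_induction_on with
  | _ t ih =>
  have hanti : ∀ i j, i < j → j ≤ t → γ j < γ i := by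
    intro i j hij
    induction j, hij using Nat.le_induction with
    | base => exact fun h => ih i (by omega) (by omega)
    | succ j _ ihj => exact fun h => (ih j (by omega) (by omega)).trans (ihj (by omega))
  by_cases hneg : -1 ≤ γ t
  · have hnn : ∀ j < t, 0 ≤ γ j := fun j hj => by have := hanti j t hj le_rfl; omega
    have h1 := hg (t + 1) (by omega) (by omega)
    have h2 := hg (t + 2) (by omega) (by omega)
    -- C(γ_t + 1, 1) absorbs the extra 1 in g(t+1). It may equal γ_{t-1}, so a weak last inequality
    -- is needed in the cascade.
    obtain ⟨c, hc⟩ := Int.eq_ofNat_of_zero_le (show 0 ≤ γ t + 1 by omega)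
    have h3 := hKK (t + 1) t (fun j => (γ j).toNat) c ht le_rfl
      (fun i j hij hj => by
        have := hanti i j hij hj.le
        have := hnn j hj
        omega)
      (fun j hj => by
        have := hanti j t (by omega) le_rfl
        omega)
      (by
        rw [← Nat.cast_le (α := ℤ), Nat.cast_add, sum_choose_toNat hnn, h1,
          Finset.sum_range_succ, show t + 1 - t = 1 by omega, Ring.choose_one_right,
          Nat.choose_one_right]
        omega)
    have h4 := Ring.choose_succ_succ (γ t) 1
    rw [← Nat.cast_le (α := ℤ), Nat.cast_add, sum_choose_toNat hnn, show t + 1 + 1 = t + 2 from rfl,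
      h2, Finset.sum_range_succ, Finset.sum_range_succ, ← Ring.choose_natCast (R := ℤ) c,
      show t + 2 - t = 2 by omega, show t + 2 - (t + 1) = 1 by omega,
      ← hc] at h3
    simp only [Ring.choose_one_right, one_add_one_eq_two] at h3 h4
    omega
  · push Not at hneg
    have hex : ∃ l, γ l < 0 := ⟨t, by omega⟩
    obtain ⟨l, hl, hlt⟩ : ∃ l, γ l < 0 ∧ ∀ j < l, 0 ≤ γ j :=
      ⟨Nat.find hex, Nat.find_spec hex, fun j hj => not_lt.1 (Nat.find_min hex hj)⟩
    have hlt' : l ≤ t := by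
      by_contra! h
      have := hlt t h
      omega
    -- At r = l+1 the remainder γ_l + 1 is at most 0; Kruskal–Katona with c = 0 propagates the
    -- bound.
    have hbound : ∀ r, l + 1 ≤ r → r ≤ K →
        (g r : ℤ) ≤ ∑ j ∈ Finset.range l, Ring.choose (γ j) (r - j) := by
      intro r hr
      induction r, hr using Nat.le_induction with
      | base =>
        intro hK
        rw [hg _ (by omega) hK, Finset.sum_range_succ, show l + 1 - l = 1 by omega,
          Ring.choose_one_right]
        omega
      | succ r hr ihr =>
        intro hK
        have h1 := hKK r l (fun j => (γ j).toNat) 0 hK hr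
          (fun i j hij hj => by
            have := hanti i j hij (by omega)
            have := hlt j hj
            omega)
          (fun _ _ => Nat.zero_le _)
        rw [Nat.choose_eq_zero_of_lt (by omega), Nat.choose_eq_zero_of_lt (by omega), add_zero,
          add_zero, ← Nat.cast_le (α := ℤ), ← Nat.cast_le (α := ℤ), sum_choose_toNat hlt,
          sum_choose_toNat hlt] at h1
        exact h1 (ihr (by omega))
    have h1 := strictMono_of_sum_choose_neg_nonpos (K := K - l) (δ := fun i => -γ (l + i))
      (fun m hm hmK => by
        have h2 := hbound (l + m) (by omega) (by omega)
        rw [hg (l + m) (by omega) (by omega), Finset.sum_range_add] at h2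
        simp only [Nat.add_sub_add_left] at h2
        rw [Finset.sum_range_succ, Nat.sub_self, Ring.choose_zero_right]
        simp only [neg_neg]
        linarith) (t - l) (by omega)
    simp only [show l + (t - l) = t by omega, show l + (t - l + 1) = t + 1 by omega] at h1
    omega

theorem mainTheorem2 (n k : ℕ) (S : Finset (Finset (Fin n)))
    (hS : S ⊆ Finset.powersetCard k (Finset.univ : Finset (Fin n))) (hne : S.Nonempty)
    (β : Fin k → ℤ) (hβ : IsShadowBinomialDecomposition k S β) :
    (∀ (i : ℕ) (hi : i + 2 < k), β ⟨i + 1, by omega⟩ < β ⟨i, by omega⟩) ∧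
      (∀ (i : ℕ) (hi : i + 2 = k), β ⟨i + 1, by omega⟩ ≤ β ⟨i, by omega⟩) := by
  -- For r < k the constant 1 is the term C(β_r, 0), absent at r = k; the shift restores it there,
  -- and makes the last inequality for `β` weak.
  let γ : ℕ → ℤ := fun j => if h : j < k then β ⟨j, h⟩ - if j + 1 < k then 0 else 1 else 0
  have hsize : ∀ r, r ≤ k → ((Finset.shadow^[k - r] S : Finset (Finset (Fin n))) :
      Set (Finset (Fin n))).Sized r := by
    intro r hr
    have h1 : (S : Set (Finset (Fin n))).Sized k := fun A hA => (Finset.mem_powersetCard.1 (hS hA)).2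
    have h2 := h1.shadow_iterate (k := k - r)
    rwa [Nat.sub_sub_self hr] at h2
  have key : ∀ t, t + 2 ≤ k → γ (t + 1) < γ t := by
    refine coeff_lt_of_kruskal_katona (K := k)
      (g := fun r => (Finset.shadow^[k - r] S).card) ?_ ?_
    · intro r hr hrk
      obtain ⟨t, rfl⟩ : ∃ t, r = t + 1 := ⟨r - 1, by omega⟩
      rw [hβ (k - (t + 1)) (by omega)]
      have h1 := sum_intBinom_eq β t (by omega)
      rw [show (k : ℤ) - ((k - (t + 1) : ℕ) : ℤ) = t + 1 by omega, h1, Finset.sum_range_succ,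
        ← Fin.sum_univ_eq_sum_range (fun j => Ring.choose (γ j) (t + 1 - j)),
        show t + 1 - t = 1 by omega, Ring.choose_one_right]
      have h2 : ∀ j : Fin t, Ring.choose (γ j) (t + 1 - j) =
          intBinom (β ⟨j, by omega⟩) ((t : ℤ) + 1 - (j : ℤ)) := by
        intro j
        have hj := j.2
        simp only [γ, intBinom]
        rw [dif_pos (by omega), if_pos (by omega), if_neg (by omega), sub_zero,
          show ((t : ℤ) + 1 - (j : ℤ)).toNat = t + 1 - j by omega]
      rw [Finset.sum_congr rfl fun j _ => h2 j]
      simp only [γ]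
      rw [dif_pos (by omega)]
      split_ifs <;> ring
    · intro r l a c hr hl ha hc h
      refine card_le_of_card_shadow_le_cascade (hsize (r + 1) hr) l a c hl ha hc ?_
      rwa [← Function.iterate_succ_apply' Finset.shadow,
        show (k - (r + 1)).succ = k - r by omega]
  constructor
  · intro i hi
    have := key i (by omega)
    simp only [γ] at this
    rw [dif_pos (by omega), dif_pos (by omega), if_pos (by omega), if_pos (by omega)] at this
    omega
  · intro i hi
    have := key i (by omega)
    simp only [γ] at this
    rw [dif_pos (by omega), dif_pos (by omega), if_neg (by omega), if_pos (by omega)] at this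
    omega
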